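/- Let $k$ be a field of characteristic zero. For an associative unital $k$-algebra $A$ put $[a,b]=ab-ba$, $L_1(A)=A$ and, for $i\ge 1$, let $L_{i+1}(A)=[A,L_i(A)]$ be the $k$-linear span of the commutators $[a,b]$ with $a\in A$, $b\in L_i(A)$. Let $M_i(A)=A\,L_i(A)\,A$ be the two-sided ideal of $A$ generated by $L_i(A)$. Call a pair $(m,l)$ of positive integers null if $M_m(A)M_l(A)\subset M_{m+l-1}(A)$ for every associative unital $k$-algebra $A$. If $m,l\ge 1$ and $m+l\le 7$, then $(m,l)$ is null if and only if the unordered pair $\{m,l\}$ is neither $\{2,2\}$ nor $\{2,4\}$. -/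

import Mathlib

universe u v

namespace LieNil

-- The Lie ring structure on an associative ring given by the commutator `⁅a, b⁆ = a * b - b * a`.
attribute [local instance] LieRing.ofAssociativeRing

/-- The term `L_i(A)` of the lower central series of `A`, regarded as a Lie algebra with the
commutator bracket, numbered so that `L_1(A) = A` and `L_{i+1}(A) = [A, L_i(A)]`
(the linear span of the commutators) for `i ≥ 1`.
Mathlib's series starts at index `0`, hence the shift; the index `i = 0` is not used. -/
def L (k : Type*) (A : Type*) [Field k] [Ring A] [Algebra k A] (i : ℕ) : Submodule k A :=
  (LieModule.lowerCentralSeries k A A (i - 1)).toSubmodule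

/-- The two-sided ideal `M_i(A) = A L_i(A) A` of `A` generated by `L_i(A)`, as a product of
subspaces (the span of all products `a * x * b` with `x ∈ L_i(A)`). -/
def M (k : Type*) (A : Type*) [Field k] [Ring A] [Algebra k A] (i : ℕ) : Submodule k A :=
  ⊤ * L k A i * ⊤

/-- The pair `(m, l)` is null over `k`: `M_m(A) M_l(A) ⊆ M_{m+l-1}(A)` for every associative
unital `k`-algebra `A`. The universe of `A` is at least that of `k`, so that free algebras
over `k` are among the algebras considered. -/
def IsNull (k : Type u) [Field k] (m l : ℕ) : Prop :=
  ∀ (A : Type (max u v)) [Ring A] [Algebra k A], M k A m * M k A l ≤ M k A (m + l - 1)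

end LieNil

namespace LieNil

attribute [local instance] LieRing.ofAssociativeRing

/-! ### Sign symmetries plus a Jacobi relation force three-torsion. -/

section Multilinear

variable {α G : Type*} [AddCommGroup G]

/-! Nullity is an identity in `A / M_N` with `N = m + l - 1`, where all brackets of length `N`
vanish. Replacing one entry of such a bracket by a product and expanding by Leibniz gives relations
between products of shorter brackets. They make these products alternating in enough entries that
the Jacobi identity reads as three times the product; 3 is invertible. This gives L_m · L_3 = 0 for
m ≥ 2 (`lie_mul_lie_lie_eq_zero`), and, once the products L_4 · L_3 are known to vanish, also L_5 ·
L_2 = 0 (`lie_five_mul_lie_eq_zero`). The order of the factors does not matter, as [L_m, L_l] lies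
in L_{m+l}. Pairs containing 1 are trivial.

For {2,2} the exterior algebra E is a counterexample: its commutators are central, but products of
commutators survive. For {2,4} it is E ⊗ Λ(p, q), where p and q commute with E: there L_5 = 0 but
L_4 · L_2 ≠ 0 (`ExteriorExtension.lie_three_mul_lie_eq`). -/

theorem three_nsmul_eq_zero_of_swap (S : α → α → α → α → G)
    (hs : ∀ d f e g, S d f e g + S f d e g = 0)
    (ha : ∀ d f e g, S d f e g + S d e f g = 0)
    (hj : ∀ d f e g, S d f e g + S d e g f + S d g f e = 0) (d f e g : α) :
    3 • S d f e g = 0 := by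
  have s12 (d f e g) : S d f e g = -S f d e g := eq_neg_of_add_eq_zero_left (hs d f e g)
  have s23 (d f e g) : S d f e g = -S d e f g := eq_neg_of_add_eq_zero_left (ha d f e g)
  have s13 (d f e g) : S d f e g = -S e f d g := by rw [s12, s23, s12 f e d, neg_neg]
  have rot (d f e g) : S d f e g = S f e d g := by rw [s12, s23, neg_neg]
  have r1 := hj d f e g
  have r2 := hj f d e g
  have r3 := hj e f d g
  have r4 := hj g f e d
  rw [s12 f d e g, s13 f g d e] at r2
  rw [s13 e f d g, s12 e d g f, rot e g f d, rot g f e d] at r3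
  rw [rot g f e d, s13 g e d f, s12 g d f e] at r4
  -- `S` alternates in its first three entries, so up to sign only four values occur, indexed by the
  -- last entry; the four Jacobi relations between them give three times each value.
  linear_combination (norm := module) r1 - r2 - r3 + 2 • r4

/-- `r1` and `r1'` make `S` alternate in entries 5, 6, 7; `r2` and `r3` then reduce to sign changes
under the swaps 3↔6 and 1↔6. Hence `S` alternates in entries 1, 2, 3, and the three Jacobi terms
coincide. -/
theorem three_nsmul_eq_zero_of_leibniz (S : α → α → α → α → α → α → α → G)
    (r1 : ∀ a b c d e f g, S a b c d e f g + S a b c d f e g = 0)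
    (r1' : ∀ a b c d e f g, S a b c d e f g + S a b c d g f e = 0)
    (ha : ∀ a b c d e f g, S a b c d e f g + S b a c d e f g = 0)
    (hj : ∀ a b c d e f g, S a b c d e f g + S b c a d e f g + S c a b d e f g = 0)
    (r2 : ∀ a b d e f g h, S a b d e g f h + S a b d e h f g + S a b d g h f e +
      (S a b f g h d e + (S a b f e h d g + S a b f e g d h)) = 0)
    (r3 : ∀ c f d e g h i, S c d e g h f i + S c d e g i f h + S c d e h i f g +
      (S c d g h i f e + S f e g h i c d) + (S c e g h i f d + S f d g h i c e +
      (S f d e h i c g + (S f d e g i c h + S f d e g h c i))) = 0)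
    (a b c d e f g : α) : 3 • S a b c d e f g = 0 := by
  have s12 (a b c d e f g) : S a b c d e f g = -S b a c d e f g :=
    eq_neg_of_add_eq_zero_left (ha a b c d e f g)
  have s56 (a b c d e f g) : S a b c d e f g = -S a b c d f e g :=
    eq_neg_of_add_eq_zero_left (r1 a b c d e f g)
  have s57 (a b c d e f g) : S a b c d e f g = -S a b c d g f e :=
    eq_neg_of_add_eq_zero_left (r1' a b c d e f g)
  have s67 (a b c d e f g) : S a b c d e f g = -S a b c d e g f := by
    rw [s56, s57, s56 a b c d g, neg_neg]
  have s36 (a b d g h f e) : S a b d g h f e = -S a b f g h d e := by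
    have key := r2 a b d e f g h
    rw [s57 a b d e g f h, s57 a b f e h d g] at key
    linear_combination (norm := module) key
  have s37 (a b c d e f g) : S a b c d e f g = -S a b g d e f c := by
    rw [s67, s36, s67 a b g, neg_neg]
  have s16 (c e g h i f d) : S c e g h i f d = -S f e g h i c d := by
    have key := r3 c f d e g h i
    rw [s57 c d e g h f i, s37 c d e h i f g, s37 f d g h i c e, s57 f d e g i c h] at key
    linear_combination (norm := module) key
  have s13 (a b c d e f g) : S a b c d e f g = -S c b a d e f g := by
    rw [s16, s36, s16 f, neg_neg]
  have key := hj a b c d e f g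
  rw [s12 b c a, s13 c b a, s12 c a b, s13 a c b, s12 b c a, s13 c b a] at key
  linear_combination (norm := module) key

end Multilinear

/-! ### Products of brackets in rings where long brackets vanish. -/

section LieNilpotentRing

variable {Q : Type*} [Ring Q]

theorem lie_mul_right (x a b : Q) : ⁅x, a * b⁆ = ⁅x, a⁆ * b + a * ⁅x, b⁆ := by
  simp only [Ring.lie_def]; noncomm_ring

theorem lie_mul_left (a b x : Q) : ⁅a * b, x⁆ = ⁅a, x⁆ * b + a * ⁅b, x⁆ := by
  simp only [Ring.lie_def]; noncomm_ring

theorem mul_comm_of_lie_eq_zero {a b : Q} (h : ⁅a, b⁆ = 0) : a * b = b * a := by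
  rwa [Ring.lie_def, sub_eq_zero] at h

/-- Expand `⁅⁅X, e * f⁆, g⁆ = 0`; each `⁅X, f⁆` is central. -/
theorem lie_mul_lie_add_swap {X : Q} (hX : ∀ e g : Q, ⁅⁅X, e⁆, g⁆ = 0) (e f g : Q) :
    ⁅X, e⁆ * ⁅f, g⁆ + ⁅X, f⁆ * ⁅e, g⁆ = 0 := by
  have h := hX (e * f) g
  have hc : ⁅e, g⁆ * ⁅X, f⁆ = ⁅X, f⁆ * ⁅e, g⁆ :=
    (mul_comm_of_lie_eq_zero (hX f ⁅e, g⁆)).symm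
  simp only [lie_mul_right, add_lie, lie_mul_left, hX, zero_mul, mul_zero, zero_add,
    add_zero] at h
  rw [← hc]; exact h

theorem lie_mul_lie_add_swap' {X : Q} (hX : ∀ e g : Q, ⁅⁅X, e⁆, g⁆ = 0) (e f g : Q) :
    ⁅X, e⁆ * ⁅f, g⁆ + ⁅X, g⁆ * ⁅f, e⁆ = 0 := by
  have h1 := lie_mul_lie_add_swap hX e g f
  rw [← lie_skew f g, ← lie_skew f e, mul_neg, mul_neg, ← neg_add, h1, neg_zero]

theorem lie_mul_lie_lie_add_swap {C : Q} (hC : ∀ d e g : Q, ⁅⁅⁅C, d⁆, e⁆, g⁆ = 0)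
    (d f e g : Q) :
    ⁅C, d⁆ * ⁅⁅f, e⁆, g⁆ + ⁅C, f⁆ * ⁅⁅d, e⁆, g⁆ = 0 := by
  -- In the Leibniz expansion, the terms with a double bracket of `C` cancel in pairs by `h3` and
  -- `h4`.
  have h := hC (d * f) e g
  have hc : ⁅⁅d, e⁆, g⁆ * ⁅C, f⁆ = ⁅C, f⁆ * ⁅⁅d, e⁆, g⁆ := by
    refine (mul_comm_of_lie_eq_zero ?_).symm
    rw [leibniz_lie ⁅C, f⁆ ⁅d, e⁆ g, hC, ← lie_skew, hC]
    simp
  have h1 : ⁅d, e⁆ * ⁅⁅C, f⁆, g⁆ = ⁅⁅C, f⁆, g⁆ * ⁅d, e⁆ :=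
    (mul_comm_of_lie_eq_zero (hC f g ⁅d, e⁆)).symm
  have h2 : ⁅d, g⁆ * ⁅⁅C, f⁆, e⁆ = ⁅⁅C, f⁆, e⁆ * ⁅d, g⁆ :=
    (mul_comm_of_lie_eq_zero (hC f e ⁅d, g⁆)).symm
  have h3 := lie_mul_lie_add_swap' (hC d) e f g
  have h4 := lie_mul_lie_add_swap' (hC f) e d g
  simp only [lie_mul_right, add_lie, lie_mul_left, hC, zero_mul, mul_zero, zero_add,
    add_zero, hc, h1, h2] at h
  grind

theorem lie_mul_lie_lie_eq_zero (h3 : IsUnit (3 : Q)) {C : Q}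
    (hC : ∀ d e g : Q, ⁅⁅⁅C, d⁆, e⁆, g⁆ = 0) (d f e g : Q) : ⁅C, d⁆ * ⁅⁅f, e⁆, g⁆ = 0 := by
  have hs := lie_mul_lie_lie_add_swap hC
  have ha : ∀ d f e g : Q, ⁅C, d⁆ * ⁅⁅f, e⁆, g⁆ + ⁅C, d⁆ * ⁅⁅e, f⁆, g⁆ = 0 := by
    intro d f e g; rw [← lie_skew f e]; simp only [neg_lie, mul_neg, neg_add_cancel]
  have hj : ∀ d f e g : Q,
      ⁅C, d⁆ * ⁅⁅f, e⁆, g⁆ + ⁅C, d⁆ * ⁅⁅e, g⁆, f⁆ + ⁅C, d⁆ * ⁅⁅g, f⁆, e⁆ = 0 := by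
    intro d f e g
    rw [← mul_add, ← mul_add]
    simp only [Ring.lie_def]; noncomm_ring
  have h := three_nsmul_eq_zero_of_swap (fun d f e g => ⁅C, d⁆ * ⁅⁅f, e⁆, g⁆) hs ha hj d f e g
  rw [nsmul_eq_mul] at h
  exact h3.mul_right_eq_zero.1 h

theorem lie_five_mul_lie_eq_zero (h3 : IsUnit (3 : Q))
    (h6 : ∀ a b c d e f : Q, ⁅⁅⁅⁅⁅a, b⁆, c⁆, d⁆, e⁆, f⁆ = 0) (a b c d e f g : Q) :
    ⁅⁅⁅⁅a, b⁆, c⁆, d⁆, e⁆ * ⁅f, g⁆ = 0 := by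
  have h43 (a b c d e f g : Q) : ⁅⁅⁅a, b⁆, c⁆, d⁆ * ⁅⁅e, f⁆, g⁆ = 0 :=
    lie_mul_lie_lie_eq_zero h3 (h6 a b c) d e f g
  have h34 (a b c d e f g : Q) : ⁅⁅e, f⁆, g⁆ * ⁅⁅⁅a, b⁆, c⁆, d⁆ = 0 := by
    rw [← h43 a b c d e f g]
    refine (mul_comm_of_lie_eq_zero ?_).symm
    rw [leibniz_lie, h6, ← lie_skew, h6]
    simp
  have hc (a b c d e f g : Q) :
      ⁅f, g⁆ * ⁅⁅⁅⁅a, b⁆, c⁆, d⁆, e⁆ = ⁅⁅⁅⁅a, b⁆, c⁆, d⁆, e⁆ * ⁅f, g⁆ :=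
    (mul_comm_of_lie_eq_zero (h6 a b c d e ⁅f, g⁆)).symm
  have r1 (a b c d e f g : Q) := lie_mul_lie_add_swap (h6 a b c d) e f g
  have r1' (a b c d e f g : Q) := lie_mul_lie_add_swap' (h6 a b c d) e f g
  have ha (a b c d e f g : Q) :
      ⁅⁅⁅⁅a, b⁆, c⁆, d⁆, e⁆ * ⁅f, g⁆ + ⁅⁅⁅⁅b, a⁆, c⁆, d⁆, e⁆ * ⁅f, g⁆ = 0 := by
    rw [← lie_skew a b]; simp only [neg_lie, neg_mul, neg_add_cancel]
  have hj (a b c d e f g : Q) :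
      ⁅⁅⁅⁅a, b⁆, c⁆, d⁆, e⁆ * ⁅f, g⁆ + ⁅⁅⁅⁅b, c⁆, a⁆, d⁆, e⁆ * ⁅f, g⁆ +
      ⁅⁅⁅⁅c, a⁆, b⁆, d⁆, e⁆ * ⁅f, g⁆ = 0 := by
    have : ⁅⁅a, b⁆, c⁆ + ⁅⁅b, c⁆, a⁆ + ⁅⁅c, a⁆, b⁆ = 0 := by
      simp only [Ring.lie_def]; noncomm_ring
    rw [← add_mul, ← add_mul, ← add_lie, ← add_lie, ← add_lie, ← add_lie, this]
    simp
  -- A product in the third entry of the six-fold bracket, then one in the first; `h43` and `h34`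
  -- remove every L_4 · L_3 term.
  have r2 (a b d e f g h : Q) := h6 a b (d * f) e g h
  have r3 (c f d e g h i : Q) := h6 (c * f) d e g h i
  simp only [lie_mul_right, add_lie, lie_mul_left, h6, h43, h34, hc, zero_mul, mul_zero, zero_add,
    add_zero] at r2 r3
  have h := three_nsmul_eq_zero_of_leibniz
    (fun a b c d e f g => ⁅⁅⁅⁅a, b⁆, c⁆, d⁆, e⁆ * ⁅f, g⁆) r1 r1' ha hj r2 r3 a b c d e f g
  rw [nsmul_eq_mul] at h
  exact h3.mul_right_eq_zero.1 h

end LieNilpotentRing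

/-! ### The ideals M_i and the null pairs. -/

section LowerCentralSeries

variable {k : Type*} {A : Type*} [Field k] [Ring A] [Algebra k A]

theorem L_one : L k A 1 = ⊤ := by
  simp [L]

theorem L_succ {i : ℕ} (hi : 1 ≤ i) :
    L k A (i + 1) = Submodule.span k {x | ∃ a : A, ∃ b ∈ L k A i, ⁅a, b⁆ = x} := by
  obtain ⟨j, rfl⟩ := Nat.exists_eq_add_of_le' hi
  simp only [L, Nat.add_sub_cancel, LieModule.lowerCentralSeries_succ,
    LieSubmodule.lieIdeal_oper_eq_linear_span', LieSubmodule.mem_top, true_and,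
    LieSubmodule.mem_toSubmodule]

theorem L_succ_le_iff {i : ℕ} (hi : 1 ≤ i) {N : Submodule k A} :
    L k A (i + 1) ≤ N ↔ ∀ a : A, ∀ b ∈ L k A i, ⁅b, a⁆ ∈ N := by
  rw [L_succ hi, Submodule.span_le]
  refine ⟨fun h a b hb => ?_, ?_⟩
  · rw [← lie_skew]
    exact N.neg_mem (h ⟨a, b, hb, rfl⟩)
  · rintro h _ ⟨a, b, hb, rfl⟩
    rw [← lie_skew]
    exact N.neg_mem (h a b hb)

theorem lie_mem_L_succ {i : ℕ} (hi : 1 ≤ i) {x : A} (hx : x ∈ L k A i) (a : A) :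
    ⁅x, a⁆ ∈ L k A (i + 1) :=
  (L_succ_le_iff hi).1 le_rfl a x hx

/-- The linear map `x ↦ ⁅x, a⁆`. -/
def rightLie (k : Type*) {A : Type*} [Field k] [Ring A] [Algebra k A] (a : A) : A →ₗ[k] A :=
  -(LieAlgebra.ad k A a)

theorem rightLie_apply (a x : A) : rightLie k a x = ⁅x, a⁆ := by
  rw [rightLie, LinearMap.neg_apply, LieAlgebra.ad_apply, lie_skew]

/-- Peels off one bracket; iterated, it reduces a linear condition on L_i to left-normed brackets of
arbitrary elements. -/
theorem L_succ_le_comap {i : ℕ} (hi : 1 ≤ i) {N : Submodule k A} {φ : A →ₗ[k] A}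
    (h : ∀ a, L k A i ≤ N.comap (φ ∘ₗ rightLie k a)) : L k A (i + 1) ≤ N.comap φ :=
  (L_succ_le_iff hi).2 fun a b hb => by
    simpa only [Submodule.mem_comap, LinearMap.comp_apply, rightLie_apply] using h a hb

theorem mem_L_one (x : A) : x ∈ L k A 1 := L_one (k := k) (A := A) ▸ Submodule.mem_top

theorem L_succ_le (i : ℕ) : L k A (i + 1) ≤ L k A i :=
  LieModule.antitone_lowerCentralSeries k A A (Nat.sub_le_sub_right i.le_succ 1)

theorem lie_mem_L_add {m n : ℕ} (hm : 1 ≤ m) (hn : 1 ≤ n) {x y : A} (hx : x ∈ L k A m)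
    (hy : y ∈ L k A n) : ⁅x, y⁆ ∈ L k A (m + n) := by
  induction n, hn using Nat.le_induction generalizing m x y with
  | base => exact lie_mem_L_succ hm hx y
  | succ n hn ih =>
    have key : L k A (n + 1) ≤ (L k A (m + (n + 1))).comap (LieAlgebra.ad k A x) := by
      refine (L_succ_le_iff hn).2 fun a b hb => ?_
      rw [Submodule.mem_comap, LieAlgebra.ad_apply, leibniz_lie]
      have h1 := lie_mem_L_succ (hm.trans (Nat.le_add_right m n)) (ih hm hx hb) a
      have h2 := ih (m := m + 1) (by omega) (lie_mem_L_succ hm hx a) hb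
      rw [← lie_skew b]
      rw [add_assoc] at h1
      rw [add_assoc, add_comm 1] at h2
      exact add_mem h1 (neg_mem h2)
    exact key hy

theorem top_mul_M_le (i : ℕ) : ⊤ * M k A i ≤ M k A i := by
  rw [M, ← mul_assoc, ← mul_assoc]
  exact mul_le_mul' (mul_le_mul' le_top le_rfl) le_rfl

theorem M_mul_top_le (i : ℕ) : M k A i * ⊤ ≤ M k A i := by
  rw [M, mul_assoc]
  exact mul_le_mul' le_rfl le_top

theorem L_le_M (i : ℕ) : L k A i ≤ M k A i := fun x hx => by
  have := Submodule.mul_mem_mul (Submodule.mul_mem_mul (Submodule.mem_top (x := (1 : A))) hx)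
    (Submodule.mem_top (x := (1 : A)))
  rwa [one_mul, mul_one] at this

/-- `M_i(A)` as an ideal of `A`. -/
def idealM (k A : Type*) [Field k] [Ring A] [Algebra k A] (i : ℕ) : Ideal A where
  carrier := M k A i
  add_mem' := (M k A i).add_mem
  zero_mem' := (M k A i).zero_mem
  smul_mem' a _ hx := top_mul_M_le i (Submodule.mul_mem_mul (Submodule.mem_top (x := a)) hx)

theorem mem_idealM {i : ℕ} {x : A} : x ∈ idealM k A i ↔ x ∈ M k A i := Iff.rfl

instance (i : ℕ) : (idealM k A i).IsTwoSided where
  mul_mem_of_left b hx :=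
    mem_idealM.2 (M_mul_top_le i (Submodule.mul_mem_mul (mem_idealM.1 hx) (Submodule.mem_top (x := b))))

/-- Since L_m A ⊆ A L_m, the middle factor of A moves to the left. -/
theorem M_mul_M_le {m l N : ℕ} (hm : 1 ≤ m)
    (h : ∀ x ∈ L k A m, ∀ y ∈ L k A l, x * y ∈ M k A N) : M k A m * M k A l ≤ M k A N := by
  have h1 : L k A m * ⊤ ≤ ⊤ * L k A m := by
    refine Submodule.mul_le.2 fun x hx a _ => ?_
    have : x * a = a * x + 1 * ⁅x, a⁆ := by rw [Ring.lie_def]; noncomm_ring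
    rw [this]
    exact add_mem (Submodule.mul_mem_mul Submodule.mem_top hx)
      (Submodule.mul_mem_mul Submodule.mem_top (L_succ_le m (lie_mem_L_succ hm hx a)))
  calc M k A m * M k A l = ⊤ * (L k A m * (⊤ * ⊤)) * L k A l * ⊤ := by
        simp only [M, mul_assoc]
    _ ≤ ⊤ * (L k A m * ⊤) * L k A l * ⊤ :=
        mul_le_mul' (mul_le_mul' (mul_le_mul' le_rfl
          (mul_le_mul' le_rfl le_top)) le_rfl) le_rfl
    _ ≤ ⊤ * (⊤ * L k A m) * L k A l * ⊤ :=
        mul_le_mul' (mul_le_mul' (mul_le_mul' le_rfl h1) le_rfl) le_rfl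
    _ = ⊤ * (⊤ * (L k A m * L k A l) * ⊤) := by simp only [mul_assoc]
    _ ≤ ⊤ * (⊤ * M k A N * ⊤) :=
        mul_le_mul' le_rfl (mul_le_mul' (mul_le_mul' le_rfl
          (Submodule.mul_le.2 h)) le_rfl)
    _ ≤ M k A N :=
        (mul_le_mul' le_rfl ((mul_le_mul' (top_mul_M_le N) le_rfl).trans
          (M_mul_top_le N))).trans (top_mul_M_le N)

theorem M_mul_M_le_symm {m l : ℕ} (hm : 1 ≤ m) (hl : 1 ≤ l)
    (h : ∀ x ∈ L k A m, ∀ y ∈ L k A l, x * y ∈ M k A (m + l - 1)) :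
    M k A l * M k A m ≤ M k A (l + m - 1) := by
  refine M_mul_M_le hl fun y hy x hx => ?_
  rw [add_comm l m]
  have h1 : ⁅x, y⁆ ∈ L k A (m + l - 1) := by
    have := lie_mem_L_add hm hl hx hy
    obtain ⟨n, hn⟩ := Nat.exists_eq_add_of_le' (hm.trans (Nat.le_add_right m l))
    rw [hn] at this ⊢
    exact L_succ_le n this
  have : y * x = x * y - ⁅x, y⁆ := by rw [Ring.lie_def]; noncomm_ring
  rw [this]
  exact sub_mem (h x hx y hy) (L_le_M _ h1)

theorem isUnit_three [CharZero k] {Q : Type*} [Ring Q] (f : A →+* Q) : IsUnit (3 : Q) := by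
  have : IsUnit (3 : k) := isUnit_iff_ne_zero.2 (by norm_num)
  simpa only [map_ofNat] using (this.map (algebraMap k A)).map f

theorem map_lie_ring {Q : Type*} [Ring Q] (f : A →+* Q) (x y : A) : f ⁅x, y⁆ = ⁅f x, f y⁆ := by
  simp only [Ring.lie_def, map_sub, map_mul]

/-- The canonical map from `A` to its quotient by `M_i(A)`. -/
def mkM (k A : Type*) [Field k] [Ring A] [Algebra k A] (i : ℕ) : A →+* A ⧸ idealM k A i :=
  Ideal.Quotient.mk (idealM k A i)

theorem mkM_surjective (i : ℕ) : Function.Surjective (mkM k A i) :=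
  Ideal.Quotient.mk_surjective

theorem mkM_eq_zero_iff {i : ℕ} {x : A} : mkM k A i x = 0 ↔ x ∈ M k A i :=
  Ideal.Quotient.eq_zero_iff_mem

theorem mkM_eq_zero_of_mem_L {i : ℕ} {x : A} (hx : x ∈ L k A i) : mkM k A i x = 0 :=
  mkM_eq_zero_iff.2 (L_le_M i hx)

theorem mul_mem_M_of_mem_L_three [CharZero k] {l : ℕ} (hl : 1 ≤ l) {x y : A}
    (hx : x ∈ L k A (l + 1)) (hy : y ∈ L k A 3) : x * y ∈ M k A (l + 3) := by
  have h1 (g : A) : L k A 2 ≤ ((M k A (l + 3)).comap (LinearMap.mulLeft k x)).comap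
      (LieAlgebra.ad k A g) := by
    refine (L_succ_le_iff le_rfl).2 fun e f _ => ?_
    have h2 : L k A (l + 1) ≤ (M k A (l + 3)).comap (LinearMap.mulRight k ⁅g, ⁅f, e⁆⁆) := by
      refine (L_succ_le_iff hl).2 fun d c hc => ?_
      have hC (d e g : A ⧸ idealM k A (l + 3)) : ⁅⁅⁅mkM k A (l + 3) c, d⁆, e⁆, g⁆ = 0 := by
        obtain ⟨d, rfl⟩ := mkM_surjective _ d
        obtain ⟨e, rfl⟩ := mkM_surjective _ e
        obtain ⟨g, rfl⟩ := mkM_surjective _ g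
        simp only [← map_lie_ring]
        exact mkM_eq_zero_of_mem_L (lie_mem_L_succ (by omega)
          (lie_mem_L_succ (by omega) (lie_mem_L_succ hl hc d) e) g)
      rw [Submodule.mem_comap, LinearMap.mulRight_apply, ← lie_skew g, mul_neg]
      refine neg_mem (mkM_eq_zero_iff.1 ?_)
      simp only [map_mul, map_lie_ring]
      exact lie_mul_lie_lie_eq_zero (isUnit_three (k := k) (mkM k A (l + 3))) hC _ _ _ _
    exact h2 hx
  have h3 : L k A 3 ≤ (M k A (l + 3)).comap (LinearMap.mulLeft k x) := by
    refine (L_succ_le_iff (by norm_num)).2 fun g w hw => ?_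
    rw [← lie_skew]
    exact neg_mem (h1 g hw)
  exact h3 hy

theorem mul_mem_M_six [CharZero k] {x y : A}
    (hx : x ∈ L k A 5) (hy : y ∈ L k A 2) : x * y ∈ M k A 6 := by
  have h6 (a b c d e f : A ⧸ idealM k A 6) : ⁅⁅⁅⁅⁅a, b⁆, c⁆, d⁆, e⁆, f⁆ = 0 := by
    obtain ⟨a, rfl⟩ := mkM_surjective _ a
    obtain ⟨b, rfl⟩ := mkM_surjective _ b
    obtain ⟨c, rfl⟩ := mkM_surjective _ c
    obtain ⟨d, rfl⟩ := mkM_surjective _ d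
    obtain ⟨e, rfl⟩ := mkM_surjective _ e
    obtain ⟨f, rfl⟩ := mkM_surjective _ f
    simp only [← map_lie_ring]
    exact mkM_eq_zero_of_mem_L (lie_mem_L_succ (by norm_num) (lie_mem_L_succ (by norm_num)
      (lie_mem_L_succ (by norm_num) (lie_mem_L_succ (by norm_num)
        (lie_mem_L_succ le_rfl (mem_L_one a) b) c) d) e) f)
  have h (u v : A) : x * ⁅u, v⁆ ∈ M k A 6 := by
    have h5 : L k A 5 ≤ (M k A 6).comap (LinearMap.mulRight k ⁅u, v⁆) := by
      refine L_succ_le_comap (by norm_num) fun e => L_succ_le_comap (by norm_num) fun d =>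
        L_succ_le_comap (by norm_num) fun c => L_succ_le_comap le_rfl fun b a _ => ?_
      simp only [Submodule.mem_comap, LinearMap.comp_apply, rightLie_apply,
        LinearMap.mulRight_apply]
      refine mkM_eq_zero_iff.1 ?_
      simp only [map_mul, map_lie_ring]
      exact lie_five_mul_lie_eq_zero (isUnit_three (k := k) (mkM k A 6)) h6 _ _ _ _ _ _ _
    exact h5 hx
  have h2 : L k A 2 ≤ (M k A 6).comap (LinearMap.mulLeft k x) :=
    (L_succ_le_iff le_rfl).2 fun v u _ => h u v
  exact h2 hy

theorem M_one_mul_M_le (l : ℕ) : M k A 1 * M k A l ≤ M k A (1 + l - 1) := by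
  rw [Nat.add_sub_cancel_left]
  exact (mul_le_mul' le_top le_rfl).trans (top_mul_M_le l)

theorem M_mul_M_one_le (l : ℕ) : M k A l * M k A 1 ≤ M k A (l + 1 - 1) :=
  (mul_le_mul' le_rfl le_top).trans (M_mul_top_le l)

theorem M_mul_M_three_le [CharZero k] {l : ℕ} (hl : 2 ≤ l) :
    M k A l * M k A 3 ≤ M k A (l + 3 - 1) := by
  obtain ⟨j, rfl⟩ := Nat.exists_eq_add_of_le' hl
  exact M_mul_M_le (by omega) fun x hx y hy => mul_mem_M_of_mem_L_three (by omega) hx hy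

theorem M_three_mul_M_le [CharZero k] {l : ℕ} (hl : 2 ≤ l) :
    M k A 3 * M k A l ≤ M k A (3 + l - 1) := by
  obtain ⟨j, rfl⟩ := Nat.exists_eq_add_of_le' hl
  exact M_mul_M_le_symm (by omega) (by omega) fun x hx y hy =>
    mul_mem_M_of_mem_L_three (by omega) hx hy

theorem M_five_mul_M_two_le [CharZero k] : M k A 5 * M k A 2 ≤ M k A (5 + 2 - 1) :=
  M_mul_M_le (by norm_num) fun _ hx _ hy => mul_mem_M_six hx hy

theorem M_two_mul_M_five_le [CharZero k] : M k A 2 * M k A 5 ≤ M k A (2 + 5 - 1) :=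
  M_mul_M_le_symm (by norm_num) (by norm_num) fun _ hx _ hy => mul_mem_M_six hx hy

end LowerCentralSeries

/-! ### The exterior algebra: commutators are central. -/

section Exterior

open ExteriorAlgebra

variable {R V : Type*} [CommRing R] [AddCommGroup V] [Module R V]

theorem commute_ι_of_mem_even {x : ExteriorAlgebra R V}
    (hx : x ∈ CliffordAlgebra.evenOdd (0 : QuadraticForm R V) 0) (v : V) :
    ι R v * x = x * ι R v := by
  induction x, hx using CliffordAlgebra.even_induction with
  | algebraMap r => exact (Algebra.commutes r _).symm
  | add x y _ _ hx hy => rw [mul_add, add_mul, hx, hy]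
  | ι_mul_ι_mul a b x _ hx =>
    have h1 : ι R v * ι R a = -(ι R a * ι R v) := eq_neg_of_add_eq_zero_left (ι_add_mul_swap v a)
    have h2 : ι R v * ι R b = -(ι R b * ι R v) := eq_neg_of_add_eq_zero_left (ι_add_mul_swap v b)
    change ι R v * (ι R a * ι R b * x) = ι R a * ι R b * x * ι R v
    calc _ = (ι R v * ι R a) * ι R b * x := by noncomm_ring
      _ = -(ι R a * (ι R v * ι R b) * x) := by rw [h1]; noncomm_ring
      _ = ι R a * ι R b * (ι R v * x) := by rw [h2]; noncomm_ring
      _ = _ := by rw [hx]; noncomm_ring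

theorem anticommute_ι_of_mem_odd {x : ExteriorAlgebra R V}
    (hx : x ∈ CliffordAlgebra.evenOdd (0 : QuadraticForm R V) 1) (v : V) :
    ι R v * x = -(x * ι R v) := by
  induction x, hx using CliffordAlgebra.odd_induction with
  | ι a => exact eq_neg_of_add_eq_zero_left (ι_add_mul_swap v a)
  | add x y _ _ hx hy => rw [mul_add, add_mul, hx, hy, neg_add]
  | ι_mul_ι_mul a b x _ hx =>
    have h1 : ι R v * ι R a = -(ι R a * ι R v) := eq_neg_of_add_eq_zero_left (ι_add_mul_swap v a)
    have h2 : ι R v * ι R b = -(ι R b * ι R v) := eq_neg_of_add_eq_zero_left (ι_add_mul_swap v b)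
    change ι R v * (ι R a * ι R b * x) = -(ι R a * ι R b * x * ι R v)
    calc _ = (ι R v * ι R a) * ι R b * x := by noncomm_ring
      _ = -(ι R a * (ι R v * ι R b) * x) := by rw [h1]; noncomm_ring
      _ = ι R a * ι R b * (ι R v * x) := by rw [h2]; noncomm_ring
      _ = _ := by rw [hx]; noncomm_ring

theorem mul_comm_of_mem_even {x : ExteriorAlgebra R V}
    (hx : x ∈ CliffordAlgebra.evenOdd (0 : QuadraticForm R V) 0) (y : ExteriorAlgebra R V) :
    y * x = x * y := by
  induction y using ExteriorAlgebra.induction with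
  | algebraMap r => exact Algebra.commutes r x
  | ι v => exact commute_ι_of_mem_even hx v
  | mul a b ha hb => rw [mul_assoc, hb, ← mul_assoc, ha, mul_assoc]
  | add a b ha hb => rw [mul_add, add_mul, ha, hb]

theorem mul_anticomm_of_mem_odd {x y : ExteriorAlgebra R V}
    (hx : x ∈ CliffordAlgebra.evenOdd (0 : QuadraticForm R V) 1)
    (hy : y ∈ CliffordAlgebra.evenOdd (0 : QuadraticForm R V) 1) : y * x = -(x * y) := by
  induction y, hy using CliffordAlgebra.odd_induction with
  | ι v => exact anticommute_ι_of_mem_odd hx v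
  | add a b _ _ ha hb => rw [mul_add, add_mul, ha, hb, neg_add]
  | ι_mul_ι_mul a b y _ hy =>
    change ι R a * ι R b * y * x = -(x * (ι R a * ι R b * y))
    have h1 := anticommute_ι_of_mem_odd hx a
    have h2 := anticommute_ι_of_mem_odd hx b
    calc _ = ι R a * ι R b * (y * x) := by noncomm_ring
      _ = -(ι R a * (ι R b * x) * y) := by rw [hy]; noncomm_ring
      _ = (ι R a * x) * ι R b * y := by rw [h2]; noncomm_ring
      _ = _ := by rw [h1]; noncomm_ring

theorem exists_even_add_odd (x : ExteriorAlgebra R V) :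
    ∃ y ∈ CliffordAlgebra.evenOdd (0 : QuadraticForm R V) 0,
      ∃ z ∈ CliffordAlgebra.evenOdd (0 : QuadraticForm R V) 1, y + z = x :=
  Submodule.mem_sup.1 <| (CliffordAlgebra.evenOdd_isCompl (0 : QuadraticForm R V)).sup_eq_top ▸
    Submodule.mem_top

theorem lie_lie_exteriorAlgebra (x y z : ExteriorAlgebra R V) : ⁅⁅x, y⁆, z⁆ = 0 := by
  obtain ⟨x0, hx0, x1, hx1, rfl⟩ := exists_even_add_odd x
  obtain ⟨y0, hy0, y1, hy1, rfl⟩ := exists_even_add_odd y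
  -- Even parts are central, so only the odd parts contribute, and their product is even.
  have h : ⁅x0 + x1, y0 + y1⁆ = 2 * (x1 * y1) := by
    simp only [Ring.lie_def, mul_add, add_mul, mul_comm_of_mem_even hx0 y0,
      mul_comm_of_mem_even hx0 y1, mul_comm_of_mem_even hy0 x1,
      mul_anticomm_of_mem_odd hx1 hy1]
    noncomm_ring
  have h2 : x1 * y1 ∈ CliffordAlgebra.evenOdd (0 : QuadraticForm R V) 0 := by
    have := CliffordAlgebra.evenOdd_mul_le (0 : QuadraticForm R V) 1 1
      (Submodule.mul_mem_mul hx1 hy1)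
    rwa [show (1 + 1 : ZMod 2) = 0 from rfl] at this
  rw [h, two_mul, add_lie, Ring.lie_def, mul_comm_of_mem_even h2 z, sub_self, add_zero]

theorem lie_ι_ι (v w : V) : ⁅ι R v, ι R w⁆ = (2 : R) • (ι R v * ι R w) := by
  rw [Ring.lie_def, eq_neg_of_add_eq_zero_left (ι_add_mul_swap w v), two_smul, sub_neg_eq_add]

theorem ιMulti_ne_zero (F : Type*) [Field F] {n : ℕ} :
    ∃ v : Fin n → ULift.{v} (Fin n → F), ιMulti F n v ≠ 0 := by
  let e : ULift.{v} (Fin n → F) ≃ₗ[F] (Fin n → F) := ULift.moduleEquiv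
  let d : ULift.{v} (Fin n → F) [⋀^Fin n]→ₗ[F] F :=
    (Matrix.detRowAlternating (R := F) (n := Fin n)).compLinearMap e.toLinearMap
  refine ⟨fun i => e.symm (Pi.single i 1), fun h => ?_⟩
  have h1 := liftAlternating_apply_ιMulti (R := F)
    (Function.update (fun _ => 0) n d) (fun i => e.symm (Pi.single i 1))
  rw [h, map_zero] at h1
  have h2 : Matrix.det (fun i j : Fin n => (Pi.single i 1 : Fin n → F) j) = 0 := by
    rw [Function.update_self] at h1
    simp only [d, AlternatingMap.compLinearMap_apply, LinearEquiv.coe_coe,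
      LinearEquiv.apply_symm_apply] at h1
    exact h1.symm
  have h3 : (fun i j : Fin n => (Pi.single i 1 : Fin n → F) j) = (1 : Matrix (Fin n) (Fin n) F) := by
    ext i j
    simp [Matrix.one_apply, Pi.single_apply, eq_comm]
  rw [h3, Matrix.det_one] at h2
  exact one_ne_zero h2

theorem exists_lie_nilpotent_two (k : Type u) [Field k] [CharZero k] :
    ∃ (E : Type (max u v)) (_ : Ring E) (_ : Algebra k E), (∀ x y z : E, ⁅⁅x, y⁆, z⁆ = 0) ∧
      ∃ a b c d e f : E, ⁅a, b⁆ * ⁅c, d⁆ * ⁅e, f⁆ ≠ 0 := by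
  -- Three commutators, needed for {2,4}, use six independent vectors.
  obtain ⟨w, hw⟩ := ιMulti_ne_zero.{v} k (n := 6)
  refine ⟨ExteriorAlgebra k (ULift.{v} (Fin 6 → k)), inferInstance, inferInstance,
    lie_lie_exteriorAlgebra, ι k (w 0), ι k (w 1), ι k (w 2), ι k (w 3), ι k (w 4), ι k (w 5), ?_⟩
  have h : ιMulti k 6 w = ι k (w 0) * ι k (w 1) * (ι k (w 2) * ι k (w 3)) *
      (ι k (w 4) * ι k (w 5)) := by
    simp only [ιMulti_apply, List.ofFn_succ, List.ofFn_zero, List.prod_cons, List.prod_nil, mul_one,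
      mul_assoc]
    rfl
  rw [lie_ι_ι, lie_ι_ι, lie_ι_ι]
  simp only [smul_mul_assoc, mul_smul_comm, smul_smul, ← h]
  exact smul_ne_zero (by norm_num) hw

end Exterior

/-- The tensor product of `E` with the exterior algebra on two generators `p`, `q`: the elements
are the sums `c₀ + c₁ p + c₂ q + c₃ p q` with coefficients in `E`. -/
@[ext]
structure ExteriorExtension (E : Type*) where
  /-- The coefficient of `1`. -/
  c₀ : E
  /-- The coefficient of `p`. -/
  c₁ : E
  /-- The coefficient of `q`. -/
  c₂ : E
  /-- The coefficient of `p q`. -/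
  c₃ : E

/-! ### The ring E ⊗ Λ(p, q). -/

namespace ExteriorExtension

/-- The tuple of coefficients. -/
def equivProd (E : Type*) : ExteriorExtension E ≃ E × E × E × E where
  toFun x := (x.c₀, x.c₁, x.c₂, x.c₃)
  invFun x := ⟨x.1, x.2.1, x.2.2.1, x.2.2.2⟩

variable {E : Type*} [Ring E]

instance : AddCommGroup (ExteriorExtension E) := (equivProd E).addCommGroup

instance {k : Type*} [Field k] [Algebra k E] : Module k (ExteriorExtension E) :=
  (equivProd E).module k

instance : Mul (ExteriorExtension E) where
  mul x y := ⟨x.c₀ * y.c₀, x.c₀ * y.c₁ + x.c₁ * y.c₀, x.c₀ * y.c₂ + x.c₂ * y.c₀,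
    x.c₀ * y.c₃ + x.c₃ * y.c₀ + x.c₁ * y.c₂ - x.c₂ * y.c₁⟩

instance : One (ExteriorExtension E) where
  one := ⟨1, 0, 0, 0⟩

theorem mul_def (x y : ExteriorExtension E) : x * y =
    ⟨x.c₀ * y.c₀, x.c₀ * y.c₁ + x.c₁ * y.c₀, x.c₀ * y.c₂ + x.c₂ * y.c₀,
      x.c₀ * y.c₃ + x.c₃ * y.c₀ + x.c₁ * y.c₂ - x.c₂ * y.c₁⟩ := rfl

theorem one_def : (1 : ExteriorExtension E) = ⟨1, 0, 0, 0⟩ := rfl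

theorem zero_def : (0 : ExteriorExtension E) = ⟨0, 0, 0, 0⟩ := rfl

theorem add_def (x y : ExteriorExtension E) :
    x + y = ⟨x.c₀ + y.c₀, x.c₁ + y.c₁, x.c₂ + y.c₂, x.c₃ + y.c₃⟩ := rfl

theorem sub_def (x y : ExteriorExtension E) :
    x - y = ⟨x.c₀ - y.c₀, x.c₁ - y.c₁, x.c₂ - y.c₂, x.c₃ - y.c₃⟩ := rfl

theorem smul_def {k : Type*} [Field k] [Algebra k E] (r : k) (x : ExteriorExtension E) :
    r • x = ⟨r • x.c₀, r • x.c₁, r • x.c₂, r • x.c₃⟩ := rfl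

instance : Ring (ExteriorExtension E) where
  __ := (inferInstance : AddCommGroup (ExteriorExtension E))
  zero_mul x := by
    simp only [mul_def, zero_def]; ext <;> dsimp only <;> noncomm_ring
  mul_zero x := by
    simp only [mul_def, zero_def]; ext <;> dsimp only <;> noncomm_ring
  one_mul x := by
    simp only [mul_def, one_def]; ext <;> dsimp only <;> noncomm_ring
  mul_one x := by
    simp only [mul_def, one_def]; ext <;> dsimp only <;> noncomm_ring
  left_distrib x y z := by
    simp only [mul_def, add_def]; ext <;> dsimp only <;> noncomm_ring
  right_distrib x y z := by
    simp only [mul_def, add_def]; ext <;> dsimp only <;> noncomm_ring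
  mul_assoc x y z := by
    simp only [mul_def]; ext <;> dsimp only <;> noncomm_ring

instance {k : Type*} [Field k] [Algebra k E] : Algebra k (ExteriorExtension E) :=
  Algebra.ofModule
    (fun r x y => by
      simp only [mul_def, smul_def, smul_mul_assoc, smul_add, smul_sub])
    (fun r x y => by
      simp only [mul_def, smul_def, mul_smul_comm, smul_add, smul_sub])

theorem lie_eq (x y : ExteriorExtension E) : ⁅x, y⁆ =
    ⟨⁅x.c₀, y.c₀⁆, ⁅x.c₀, y.c₁⁆ + ⁅x.c₁, y.c₀⁆, ⁅x.c₀, y.c₂⁆ + ⁅x.c₂, y.c₀⁆,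
      ⁅x.c₀, y.c₃⁆ + ⁅x.c₃, y.c₀⁆ + (x.c₁ * y.c₂ + y.c₂ * x.c₁) -
        (x.c₂ * y.c₁ + y.c₁ * x.c₂)⟩ := by
  simp only [Ring.lie_def, mul_def, sub_def]
  ext <;> dsimp only <;> noncomm_ring

/-- Each of the four brackets takes a commutator of coefficients or, when p meets q, an
anticommutator. The latter happens at most once, so two consecutive brackets are commutators and
`hE` applies. -/
theorem lie_five_eq_zero (hE : ∀ x y z : E, ⁅⁅x, y⁆, z⁆ = 0) (a b c d e : ExteriorExtension E) :
    ⁅⁅⁅⁅a, b⁆, c⁆, d⁆, e⁆ = 0 := by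
  simp only [lie_eq, hE, add_lie, zero_lie, zero_mul, mul_zero, add_zero, sub_zero,
    zero_def]

/-- Bracketing `⁅a, b⁆` p with c q gives the anticommutator 2 `⁅a, b⁆` c pq; bracketing with d then
turns c into `⁅c, d⁆`. -/
theorem lie_three_mul_lie_eq (hE : ∀ x y z : E, ⁅⁅x, y⁆, z⁆ = 0) (a b c d e f : E) :
    ⁅⁅⁅(⟨a, 0, 0, 0⟩ : ExteriorExtension E), (⟨0, b, 0, 0⟩ : ExteriorExtension E)⁆,
      (⟨0, 0, c, 0⟩ : ExteriorExtension E)⁆, (⟨d, 0, 0, 0⟩ : ExteriorExtension E)⁆ *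
      ⁅(⟨e, 0, 0, 0⟩ : ExteriorExtension E), (⟨f, 0, 0, 0⟩ : ExteriorExtension E)⁆ =
    ⟨0, 0, 0, 2 * (⁅a, b⁆ * ⁅c, d⁆ * ⁅e, f⁆)⟩ := by
  have h : c * ⁅a, b⁆ = ⁅a, b⁆ * c := (mul_comm_of_lie_eq_zero (hE a b c)).symm
  simp only [lie_eq, mul_def, h, hE, add_lie, zero_lie, lie_zero, zero_mul, mul_zero, add_zero,
    sub_zero, zero_add, lie_mul_left]
  ext <;> first | rfl | (dsimp only; noncomm_ring)

end ExteriorExtension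

/-! ### The pairs that are not null. -/

section NotNull

variable {k : Type*} {A : Type*} [Field k] [Ring A] [Algebra k A]

theorem M_eq_bot {i : ℕ} (h : L k A i = ⊥) : M k A i = ⊥ := by
  rw [M, h, Submodule.mul_bot, Submodule.bot_mul]

theorem not_isNull_of_mul_ne_zero {k : Type u} [Field k] {m l : ℕ} (A : Type (max u v)) [Ring A]
    [Algebra k A] (hA : L k A (m + l - 1) = ⊥) {x y : A} (hx : x ∈ L k A m) (hy : y ∈ L k A l)
    (hxy : x * y ≠ 0) : ¬ IsNull.{u, v} k m l := fun h => by
  have := h A (Submodule.mul_mem_mul (L_le_M m hx) (L_le_M l hy))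
  rw [M_eq_bot hA] at this
  exact hxy ((Submodule.mem_bot k).1 this)

theorem L_three_eq_bot (h : ∀ x y z : A, ⁅⁅x, y⁆, z⁆ = 0) : L k A 3 = ⊥ := by
  have : L k A 3 ≤ (⊥ : Submodule k A).comap LinearMap.id := by
    refine L_succ_le_comap (by norm_num) fun c => L_succ_le_comap le_rfl fun b a _ => ?_
    simp only [Submodule.mem_comap, LinearMap.comp_apply, LinearMap.id_apply, rightLie_apply, h,
      Submodule.mem_bot]
  exact le_bot_iff.1 this

theorem L_five_eq_bot (h : ∀ a b c d e : A, ⁅⁅⁅⁅a, b⁆, c⁆, d⁆, e⁆ = 0) : L k A 5 = ⊥ := by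
  have : L k A 5 ≤ (⊥ : Submodule k A).comap LinearMap.id := by
    refine L_succ_le_comap (by norm_num) fun e => L_succ_le_comap (by norm_num) fun d =>
      L_succ_le_comap (by norm_num) fun c => L_succ_le_comap le_rfl fun b a _ => ?_
    simp only [Submodule.mem_comap, LinearMap.comp_apply, LinearMap.id_apply, rightLie_apply, h,
      Submodule.mem_bot]
  exact le_bot_iff.1 this

theorem lie_mem_L_two (a b : A) : ⁅a, b⁆ ∈ L k A 2 :=
  lie_mem_L_succ le_rfl (mem_L_one a) b

theorem lie_lie_lie_mem_L_four (a b c d : A) : ⁅⁅⁅a, b⁆, c⁆, d⁆ ∈ L k A 4 :=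
  lie_mem_L_succ (by norm_num) (lie_mem_L_succ (by norm_num) (lie_mem_L_two a b) c) d

theorem not_isNull_two_two (k : Type u) [Field k] [CharZero k] : ¬ IsNull.{u, v} k 2 2 := by
  obtain ⟨E, _, _, hE, a, b, c, d, e, f, h⟩ := exists_lie_nilpotent_two.{u, v} k
  exact not_isNull_of_mul_ne_zero E (L_three_eq_bot hE) (lie_mem_L_two a b) (lie_mem_L_two c d)
    (left_ne_zero_of_mul h)

theorem exists_lie_nilpotent_four (k : Type u) [Field k] [CharZero k] :
    ∃ (B : Type (max u v)) (_ : Ring B) (_ : Algebra k B), L k B 5 = ⊥ ∧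
      ∃ x ∈ L k B 4, ∃ y ∈ L k B 2, x * y ≠ 0 := by
  obtain ⟨E, _, _, hE, a, b, c, d, e, f, h⟩ := exists_lie_nilpotent_two.{u, v} k
  refine ⟨ExteriorExtension E, inferInstance, inferInstance,
    L_five_eq_bot (ExteriorExtension.lie_five_eq_zero hE),
    _, lie_lie_lie_mem_L_four ⟨a, 0, 0, 0⟩ ⟨0, b, 0, 0⟩ ⟨0, 0, c, 0⟩ ⟨d, 0, 0, 0⟩,
    _, lie_mem_L_two ⟨e, 0, 0, 0⟩ ⟨f, 0, 0, 0⟩, fun h0 => h ?_⟩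
  rw [ExteriorExtension.lie_three_mul_lie_eq hE a b c d e f, ExteriorExtension.zero_def] at h0
  have h1 : (2 : k) • (⁅a, b⁆ * ⁅c, d⁆ * ⁅e, f⁆) = 0 := by
    rw [two_smul, ← two_mul]
    exact congrArg ExteriorExtension.c₃ h0
  exact (smul_eq_zero.1 h1).resolve_left two_ne_zero

theorem not_isNull_four_two (k : Type u) [Field k] [CharZero k] : ¬ IsNull.{u, v} k 4 2 := by
  obtain ⟨B, _, _, hB, x, hx, y, hy, h⟩ := exists_lie_nilpotent_four.{u, v} k
  exact not_isNull_of_mul_ne_zero B hB hx hy h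

theorem not_isNull_two_four (k : Type u) [Field k] [CharZero k] : ¬ IsNull.{u, v} k 2 4 := by
  obtain ⟨B, _, _, hB, x, hx, y, hy, h⟩ := exists_lie_nilpotent_four.{u, v} k
  refine not_isNull_of_mul_ne_zero B hB hy hx fun h0 => h ?_
  -- As L_5 = 0, the factors commute and the same example serves.
  have hxy : ⁅x, y⁆ ∈ L k B 5 := lie_mem_L_succ (by norm_num) hx y
  rw [hB, Submodule.mem_bot] at hxy
  rw [mul_comm_of_lie_eq_zero hxy, h0]

end NotNull

end LieNil

theorem theorem3p4 (k : Type u) [Field k] [CharZero k] (m l : ℕ)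
    (hm : 1 ≤ m) (hl : 1 ≤ l) (hml : m + l ≤ 7) :
    LieNil.IsNull.{u, v} k m l ↔ s(m, l) ≠ s(2, 2) ∧ s(m, l) ≠ s(2, 4) := by
  constructor
  · refine fun h => ⟨fun h0 => ?_, fun h0 => ?_⟩
    · obtain ⟨rfl, rfl⟩ | ⟨rfl, rfl⟩ := Sym2.eq_iff.1 h0 <;>
        exact LieNil.not_isNull_two_two k h
    · obtain ⟨rfl, rfl⟩ | ⟨rfl, rfl⟩ := Sym2.eq_iff.1 h0
      · exact LieNil.not_isNull_two_four k h
      · exact LieNil.not_isNull_four_two k h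
  · rintro ⟨h22, h24⟩ A _ _
    simp only [ne_eq, Sym2.eq_iff] at h22 h24
    have hcases : m = 1 ∨ l = 1 ∨ (l = 3 ∧ 2 ≤ m) ∨ (m = 3 ∧ 2 ≤ l) ∨ (m = 5 ∧ l = 2) ∨
      (m = 2 ∧ l = 5) := by omega
    obtain rfl | rfl | ⟨rfl, h⟩ | ⟨rfl, h⟩ | ⟨rfl, rfl⟩ | ⟨rfl, rfl⟩ := hcases
    · exact LieNil.M_one_mul_M_le l
    · exact LieNil.M_mul_M_one_le m
    · exact LieNil.M_mul_M_three_le h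
    · exact LieNil.M_three_mul_M_le h
    · exact LieNil.M_five_mul_M_two_le
    · exact LieNil.M_two_mul_M_five_le
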